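/- Let $G$ be a finite simple graph. For $X \subseteq V(G)$ let $N_G[X]$ be the set of vertices that lie in $X$ or are adjacent to a vertex of $X$; a vertex dominates itself and its neighbours. In the isolation game on $G$, two players, Dominator and Staller, alternately play a vertex of $G$. If $X$ is the set of vertices played so far, a vertex may be played if and only if it dominates some vertex belonging to a connected component with at least two vertices of the graph $G - N_G[X]$. The game ends when no vertex may be played. Dominator wants to minimize, and Staller to maximize, the total number of moves. Let $\iota_{\rm g}(G)$ (the game isolation number) and $\iota_{\rm g}'(G)$ (the Staller-start game isolation number) be the number of moves made under optimal play of both players when Dominator, respectively Staller, makes the first move. Let $C_n$ denote the cycle on $n$ vertices. **Theorem.** For every integer $n \ge 4$, $$\iota_{\rm g}(C_n) = \begin{cases} 2\left\lceil \frac{n}{5}\right\rceil & \text{if } n \equiv 0 \pmod 5,\\ 2\left\lceil \frac{n}{5}\right\rceil - 1 & \text{otherwise,}\end{cases} \qquad \iota_{\rm g}'(C_n) = \begin{cases} 2\left\lfloor \frac{n}{5}\right\rfloor + 1 & \text{if } n \equiv 4 \pmod 5,\\ 2\left\lfloor \frac{n}{5}\right\rfloor & \text{otherwise.}\end{cases}$$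 -/

import Mathlib

namespace IsolationGame

/-- The two players of the isolation game. -/
inductive Player
  | dominator
  | staller

variable {V : Type*}

/-- The closed neighbourhood `N_G[X]`: the vertices that are in `X` or adjacent to a vertex of `X`. -/
def closedNbhd (G : SimpleGraph V) (X : Set V) : Set V :=
  {w | ∃ x ∈ X, w = x ∨ G.Adj x w}

/-- `w` is a vertex of the graph `G - N_G[X]`, and the connected component of `G - N_G[X]` that
contains `w` is nontrivial, that is, has at least two vertices. -/
def InNontrivialComponent (G : SimpleGraph V) (X : Set V) (w : V) : Prop :=
  ∃ hw : w ∈ (closedNbhd G X)ᶜ,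
    ((G.induce (closedNbhd G X)ᶜ).connectedComponentMk ⟨w, hw⟩).supp.Nontrivial

/-- When `X` is the set of already played vertices, `v` may be played if and only if it dominates
(is equal or adjacent to) some vertex of a nontrivial component of `G - N_G[X]`. -/
def Playable (G : SimpleGraph V) (X : Set V) (v : V) : Prop :=
  ∃ w ∈ closedNbhd G {v}, InNontrivialComponent G X w

theorem Playable.notMem {G : SimpleGraph V} {X : Set V} {v : V} (h : Playable G X v) : v ∉ X := by
  intro hv
  obtain ⟨w, ⟨x, rfl, hw⟩, hw', -⟩ := h
  exact hw' ⟨x, hv, hw⟩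

open Classical in
/-- The set of legal moves when `X` is the set of already played vertices. -/
noncomputable def legalMoves [Fintype V] (G : SimpleGraph V) (X : Finset V) : Finset V :=
  Finset.univ.filter fun v => Playable G (X : Set V) v

theorem card_compl_insert_lt [Fintype V] [DecidableEq V] {G : SimpleGraph V} {X : Finset V} {v : V}
    (h : v ∈ legalMoves G X) : ((insert v X)ᶜ : Finset V).card < (Xᶜ : Finset V).card := by
  have hv : v ∉ X := by
    classical
    simpa using Playable.notMem (Finset.mem_filter.mp h).2
  apply Finset.card_lt_card
  rw [Finset.compl_ssubset_compl]
  exact Finset.ssubset_insert hv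

open Classical in
/-- The number of moves still to be made under optimal play, when `X` is the set of already played
vertices and the given player is to move. The game is over when there is no legal move; otherwise
the player to move must make a legal move, Dominator minimizing and Staller maximizing the
number of moves. -/
noncomputable def movesLeft [Fintype V] (G : SimpleGraph V) : Player → Finset V → ℕ
  | .dominator, X =>
    if h : (legalMoves G X).Nonempty then
      1 + (legalMoves G X).attach.inf' (Finset.attach_nonempty_iff.mpr h)
        fun v => movesLeft G .staller (insert v.1 X)
    else 0
  | .staller, X =>
    if h : (legalMoves G X).Nonempty then
      1 + (legalMoves G X).attach.sup' (Finset.attach_nonempty_iff.mpr h)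
        fun v => movesLeft G .dominator (insert v.1 X)
    else 0
termination_by _ X => (Xᶜ : Finset V).card
decreasing_by
  all_goals exact card_compl_insert_lt v.2

/-- The game isolation number (Dominator makes the first move). -/
noncomputable def gameIsolationNumber [Fintype V] (G : SimpleGraph V) : ℕ :=
  movesLeft G .dominator ∅

/-- The Staller-start game isolation number (Staller makes the first move). -/
noncomputable def stallerStartGameIsolationNumber [Fintype V] (G : SimpleGraph V) : ℕ :=
  movesLeft G .staller ∅

end IsolationGame

namespace IsolationGame

section General

variable {V : Type*}

theorem inNontrivialComponent_iff {G : SimpleGraph V} {X : Set V} {w : V} :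
    InNontrivialComponent G X w ↔
      w ∉ closedNbhd G X ∧ ∃ u, u ∉ closedNbhd G X ∧ G.Adj w u := by
  constructor
  · rintro ⟨hw, h⟩
    refine ⟨hw, ?_⟩
    obtain ⟨⟨y, hy⟩, hys, hne⟩ := h.exists_ne ⟨w, hw⟩
    have hr : (G.induce (closedNbhd G X)ᶜ).Reachable ⟨w, hw⟩ ⟨y, hy⟩ :=
      (SimpleGraph.ConnectedComponent.exact hys).symm
    obtain ⟨p⟩ := hr
    cases p with
    | nil => exact absurd rfl hne
    | cons hadj _ => exact ⟨_, Subtype.property (p := (· ∈ (closedNbhd G X)ᶜ)) _, hadj⟩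
  · rintro ⟨hw, u, hu, hadj⟩
    refine ⟨hw, ⟨w, hw⟩, rfl, ⟨u, hu⟩, ?_, fun h => hadj.ne (congrArg Subtype.val h)⟩
    apply SimpleGraph.ConnectedComponent.sound
    have hadj' : (G.induce (closedNbhd G X)ᶜ).Adj ⟨w, hw⟩ ⟨u, hu⟩ := hadj
    exact hadj'.reachable.symm

variable {G : SimpleGraph V} {X : Finset V}

theorem mem_legalMoves [Fintype V] {v : V} : v ∈ legalMoves G X ↔ Playable G (X : Set V) v := by
  simp [legalMoves]

theorem mem_closedNbhd_insert [DecidableEq V] {v w : V} :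
    w ∈ closedNbhd G ((insert v X : Finset V) : Set V) ↔
      (w = v ∨ G.Adj v w) ∨ w ∈ closedNbhd G (X : Set V) := by
  simp [closedNbhd]

theorem movesLeft_eq_zero [Fintype V] (h : ¬ (legalMoves G X).Nonempty) (P : Player) :
    movesLeft G P X = 0 := by
  cases P <;> rw [movesLeft] <;> exact dif_neg h

variable [Fintype V] [DecidableEq V]

theorem movesLeft_staller_le {B : ℕ}
    (h : ∀ v ∈ legalMoves G X, movesLeft G .dominator (insert v X) + 1 ≤ B) :
    movesLeft G .staller X ≤ B := by
  by_cases hne : (legalMoves G X).Nonempty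
  · obtain ⟨v, -, hv⟩ := Finset.exists_mem_eq_sup' (Finset.attach_nonempty_iff.mpr hne)
      fun v : legalMoves G X => movesLeft G .dominator (insert v.1 X)
    have := h v.1 v.2
    rw [movesLeft, dif_pos hne]
    convert this using 1
    rw [add_comm]
    congr 1
    convert hv
  · rw [movesLeft_eq_zero hne]
    exact Nat.zero_le _

theorem le_movesLeft_staller {v : V} (hv : v ∈ legalMoves G X) :
    movesLeft G .dominator (insert v X) + 1 ≤ movesLeft G .staller X := by
  have hne : (legalMoves G X).Nonempty := ⟨v, hv⟩
  have := Finset.le_sup' (fun v : legalMoves G X => movesLeft G .dominator (insert v.1 X))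
    (Finset.mem_attach _ ⟨v, hv⟩)
  rw [movesLeft.eq_2, dif_pos hne, add_comm]
  apply Nat.add_le_add_left
  refine le_trans this (le_of_eq ?_)
  congr!

theorem movesLeft_dominator_le {v : V} (hv : v ∈ legalMoves G X) :
    movesLeft G .dominator X ≤ movesLeft G .staller (insert v X) + 1 := by
  have hne : (legalMoves G X).Nonempty := ⟨v, hv⟩
  have := Finset.inf'_le (fun v : legalMoves G X => movesLeft G .staller (insert v.1 X))
    (Finset.mem_attach _ ⟨v, hv⟩)
  rw [movesLeft, dif_pos hne, add_comm]
  apply Nat.add_le_add_right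
  refine le_trans (le_of_eq ?_) this
  congr!

theorem le_movesLeft_dominator {B : ℕ} (hne : (legalMoves G X).Nonempty)
    (h : ∀ v ∈ legalMoves G X, B ≤ movesLeft G .staller (insert v X) + 1) :
    B ≤ movesLeft G .dominator X := by
  obtain ⟨v, -, hv⟩ := Finset.exists_mem_eq_inf' (Finset.attach_nonempty_iff.mpr hne)
    fun v : legalMoves G X => movesLeft G .staller (insert v.1 X)
  have := h v.1 v.2
  rw [movesLeft, dif_pos hne]
  convert this using 1
  rw [add_comm]
  congr 1
  convert hv

end General

section Weights

/-- The weight of a run of `r` undominated vertices in the upper bound on the number of moves. -/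
def upperWeight (r : ℕ) : ℕ :=
  2 * (r / 5) + if r % 5 = 2 then 1 else if r % 5 < 2 then 0 else 2

/-- Four times the weight of a run of `r` undominated vertices in the lower bound. -/
def lowerWeight (r : ℕ) : ℕ :=
  8 * (r / 5) + (if r % 5 < 2 then 0 else r % 5 + 2) - if r % 5 = 0 then 1 else 0

/-- Dominator can lower the upper weight of a run of this length by two. -/
def Reducible (r : ℕ) : Prop := 3 ≤ r ∧ (r % 5 = 3 ∨ r % 5 = 4 ∨ r % 5 = 0)

theorem upperWeight_split {r k : ℕ} (hr : 2 ≤ r) (hk : k ≤ r + 1) :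
    upperWeight (k - 2) + upperWeight (r - (k + 1)) + 1 ≤ upperWeight r ∨
      upperWeight (k - 2) + upperWeight (r - (k + 1)) ≤ upperWeight r ∧
        (Reducible (k - 2) ∨ Reducible (r - (k + 1))) := by
  unfold upperWeight Reducible
  generalize ha : k - 2 = a
  generalize hb : r - (k + 1) = b
  split_ifs <;> omega

theorem exists_upperWeight_split {r : ℕ} (hr : 2 ≤ r) :
    ∃ k ≤ r + 1, upperWeight (k - 2) + upperWeight (r - (k + 1)) + 1 ≤ upperWeight r := by
  refine ⟨3, by omega, ?_⟩
  unfold upperWeight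
  split_ifs <;> omega

theorem Reducible.exists_upperWeight_split {r : ℕ} (hr : Reducible r) :
    ∃ k ≤ r + 1, upperWeight (k - 2) + upperWeight (r - (k + 1)) + 2 ≤ upperWeight r := by
  unfold Reducible at hr
  refine ⟨3, by omega, ?_⟩
  unfold upperWeight
  split_ifs <;> omega

theorem lowerWeight_split {r k : ℕ} (hr : 2 ≤ r) (hk : k ≤ r + 1) :
    lowerWeight r ≤ lowerWeight (k - 2) + lowerWeight (r - (k + 1)) + 7 := by
  unfold lowerWeight
  generalize ha : k - 2 = a
  generalize hb : r - (k + 1) = b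
  split_ifs <;> omega

theorem lowerWeight_pred {r : ℕ} (hr : 2 ≤ r) (h : r % 5 ≠ 2) :
    lowerWeight r ≤ lowerWeight (r - 1) + 1 := by
  unfold lowerWeight
  split_ifs <;> omega

theorem lowerWeight_pred_of_mod_eq_two {r : ℕ} (h : r % 5 = 2) :
    lowerWeight r = lowerWeight (r - 1) + 4 := by
  unfold lowerWeight
  split_ifs <;> omega

theorem four_dvd_lowerWeight {r : ℕ} (h : 2 ≤ r → r % 5 = 2) : 4 ∣ lowerWeight r := by
  unfold lowerWeight
  split_ifs <;> omega

theorem lowerWeight_of_lt_two {r : ℕ} (h : r < 2) : lowerWeight r = 0 := by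
  unfold lowerWeight
  split_ifs <;> omega

end Weights
section Runs

variable {V : Type*}

/-- `pos` numbers the vertices by `0, …, n - 1` so that the vertices numbered `1, …, n - 2` are
adjacent exactly to the ones with consecutive numbers, and those numbered `0` and `n - 1` are
adjacent. -/
structure IsCycleNumbering (G : SimpleGraph V) (n : ℕ) (pos : V → ℕ) : Prop where
  injective : Function.Injective pos
  pos_lt : ∀ v, pos v < n
  exists_pos_eq : ∀ i < n, ∃ v, pos v = i
  adj_iff : ∀ u w, 1 ≤ pos u → pos u + 2 ≤ n →
    (G.Adj u w ↔ pos u + 1 = pos w ∨ pos w + 1 = pos u)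
  adj_of_pos_eq_zero : ∀ u w, pos u = 0 → pos w + 1 = n → G.Adj u w

/-- Two intervals, given by first element and length, are at distance at least two, or one of
them is empty. -/
def Separated (p q : ℕ × ℕ) : Prop :=
  p.2 = 0 ∨ q.2 = 0 ∨ p.1 + p.2 + 2 ≤ q.1 ∨ q.1 + q.2 + 2 ≤ p.1

instance : Std.Symm Separated where
  symm p q h := by
    unfold Separated at *
    omega

/-- The vertices not dominated by `X` are the ones whose numbers lie in the pairwise separated
intervals listed in `l`, which are given by first element and length. -/
structure IsRunList (G : SimpleGraph V) (n : ℕ) (pos : V → ℕ) (X : Set V) (l : List (ℕ × ℕ)) :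
    Prop where
  notMem_iff : ∀ x, x ∉ closedNbhd G X ↔ ∃ p ∈ l, p.1 ≤ pos x ∧ pos x < p.1 + p.2
  bounds : ∀ p ∈ l, 0 < p.2 → 1 ≤ p.1 ∧ p.1 + p.2 + 2 ≤ n
  separated : l.Pairwise Separated

variable {G : SimpleGraph V} {n : ℕ} {pos : V → ℕ}

namespace IsRunList

theorem perm {X : Set V} {l l' : List (ℕ × ℕ)} (h : IsRunList G n pos X l) (hl : l.Perm l') :
    IsRunList G n pos X l' where
  notMem_iff x := by simp only [h.notMem_iff, hl.mem_iff]
  bounds p hp := h.bounds p (hl.mem_iff.mpr hp)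
  separated := hl.pairwise h.separated fun h => symm_of _ h

theorem exists_run {X : Set V} {l : List (ℕ × ℕ)} (hpos : IsCycleNumbering G n pos)
    (h : IsRunList G n pos X l) {v : V} (hv : Playable G X v) :
    ∃ p ∈ l, 2 ≤ p.2 ∧ ∃ k ≤ p.2 + 1, pos v + 1 = p.1 + k := by
  obtain ⟨w, ⟨v', hv', hvw⟩, hw⟩ := hv
  rw [Set.mem_singleton_iff.mp hv'] at hvw
  obtain ⟨hw, u, hu, hwu⟩ := inNontrivialComponent_iff.mp hw
  obtain ⟨p, hp, hpw⟩ := (h.notMem_iff w).mp hw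
  obtain ⟨q, hq, hqu⟩ := (h.notMem_iff u).mp hu
  have hb := h.bounds p hp (by omega)
  rw [hpos.adj_iff w u (by omega) (by omega)] at hwu
  have hpq : p = q := by
    by_contra hne
    have := h.separated.forall hp hq hne
    unfold Separated at this
    omega
  subst hpq
  have hvw' : pos w = pos v ∨ pos w + 1 = pos v ∨ pos v + 1 = pos w := by
    rcases hvw with rfl | hvw
    · exact Or.inl rfl
    · exact Or.inr ((hpos.adj_iff w v (by omega) (by omega)).mp hvw.symm)
  exact ⟨p, hp, by omega, pos v + 1 - p.1, by omega, by omega⟩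

theorem exists_playable {X : Set V} {l : List (ℕ × ℕ)} (hpos : IsCycleNumbering G n pos)
    (h : IsRunList G n pos X l) {p : ℕ × ℕ} (hp : p ∈ l) (h2 : 2 ≤ p.2) {k : ℕ}
    (hk : k ≤ p.2 + 1) : ∃ v, pos v + 1 = p.1 + k ∧ Playable G X v := by
  have hb := h.bounds p hp (by omega)
  obtain ⟨v, hv⟩ := hpos.exists_pos_eq (p.1 + k - 1) (by omega)
  obtain ⟨j, hj1, hj2, hj3⟩ : ∃ j, p.1 ≤ j ∧ j < p.1 + p.2 ∧
      (j = pos v ∨ j + 1 = pos v ∨ pos v + 1 = j) := by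
    rcases Nat.eq_zero_or_pos k with h0 | h0
    · exact ⟨p.1, by omega⟩
    · exact ⟨min (pos v) (p.1 + p.2 - 1), by omega⟩
  obtain ⟨i, hi1, hi2, hi3⟩ : ∃ i, p.1 ≤ i ∧ i < p.1 + p.2 ∧ (j + 1 = i ∨ i + 1 = j) := by
    by_cases hj : j + 1 < p.1 + p.2
    · exact ⟨j + 1, by omega⟩
    · exact ⟨j - 1, by omega⟩
  obtain ⟨w, rfl⟩ := hpos.exists_pos_eq j (by omega)
  obtain ⟨u, rfl⟩ := hpos.exists_pos_eq i (by omega)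
  refine ⟨v, by omega, w, ⟨v, rfl, ?_⟩, inNontrivialComponent_iff.mpr
    ⟨(h.notMem_iff w).mpr ⟨p, hp, hj1, hj2⟩, u, (h.notMem_iff u).mpr ⟨p, hp, hi1, hi2⟩,
      (hpos.adj_iff w u (by omega) (by omega)).mpr hi3⟩⟩
  exact hj3.imp (fun h => hpos.injective h)
    fun h => ((hpos.adj_iff w v (by omega) (by omega)).mpr h).symm

theorem insert_cons [DecidableEq V] {X : Finset V} {p : ℕ × ℕ} {l : List (ℕ × ℕ)}
    (hpos : IsCycleNumbering G n pos) (h : IsRunList G n pos (X : Set V) (p :: l)) (h2 : 2 ≤ p.2)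
    {v : V} {k : ℕ} (hk : k ≤ p.2 + 1) (hv : pos v + 1 = p.1 + k) :
    IsRunList G n pos ((insert v X : Finset V) : Set V)
      ((p.1, k - 2) :: (p.1 + k + 1, p.2 - (k + 1)) :: l) := by
  have hb := h.bounds p (by simp) (by omega)
  have hsep := List.pairwise_cons.mp h.separated
  have hdom : ∀ x, 1 ≤ pos x → pos x + 2 ≤ n →
      ((x = v ∨ G.Adj v x) ↔ pos x ≤ pos v + 1 ∧ pos v ≤ pos x + 1) := by
    intro x hx hx'
    rw [G.adj_comm, hpos.adj_iff x v hx hx', ← hpos.injective.eq_iff]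
    omega
  refine ⟨fun x => ?_, fun q hq hq0 => ?_, ?_⟩
  · rw [mem_closedNbhd_insert, not_or, h.notMem_iff]
    simp only [List.mem_cons, exists_eq_or_imp]
    constructor
    · rintro ⟨hx, hxp | ⟨q, hq, hxq⟩⟩
      · rw [hdom x (by omega) (by omega)] at hx
        by_cases hlt : pos x < pos v
        · exact Or.inl (by omega)
        · exact Or.inr (Or.inl (by omega))
      · exact Or.inr (Or.inr ⟨q, hq, hxq⟩)
    · rintro (hx | hx | ⟨q, hq, hxq⟩)
      · rw [hdom x (by omega) (by omega)]
        exact ⟨by omega, Or.inl (by omega)⟩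
      · rw [hdom x (by omega) (by omega)]
        exact ⟨by omega, Or.inl (by omega)⟩
      · have hqb := h.bounds q (by simp [hq]) (by omega)
        have hs := hsep.1 q hq
        unfold Separated at hs
        rw [hdom x (by omega) (by omega)]
        exact ⟨by omega, Or.inr ⟨q, hq, hxq⟩⟩
  · simp only [List.mem_cons] at hq
    rcases hq with rfl | rfl | hq
    · simp only at hq0 ⊢
      omega
    · simp only at hq0 ⊢
      omega
    · exact h.bounds q (by simp [hq]) hq0
  · refine List.pairwise_cons.mpr ⟨fun q hq => ?_, List.pairwise_cons.mpr
      ⟨fun q hq => ?_, hsep.2⟩⟩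
    · rcases List.mem_cons.mp hq with rfl | hq
      · unfold Separated
        simp only
        omega
      · have hs := hsep.1 q hq
        unfold Separated at hs ⊢
        simp only
        omega
    · have hs := hsep.1 q hq
      unfold Separated at hs ⊢
      simp only
      omega

variable [Fintype V] [DecidableEq V] {X : Finset V} {l : List (ℕ × ℕ)}

theorem exists_split_of_mem_legalMoves (hpos : IsCycleNumbering G n pos)
    (h : IsRunList G n pos (X : Set V) l) {v : V} (hv : v ∈ legalMoves G X) :
    ∃ p l', l.Perm (p :: l') ∧ 2 ≤ p.2 ∧ ∃ k ≤ p.2 + 1,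
      IsRunList G n pos ((insert v X : Finset V) : Set V)
        ((p.1, k - 2) :: (p.1 + k + 1, p.2 - (k + 1)) :: l') := by
  obtain ⟨p, hp, h2, k, hk, hvk⟩ := h.exists_run hpos (mem_legalMoves.mp hv)
  have hl := List.perm_cons_erase hp
  exact ⟨p, _, hl, h2, k, hk, (h.perm hl).insert_cons hpos h2 hk hvk⟩

theorem exists_mem_legalMoves_split (hpos : IsCycleNumbering G n pos)
    (h : IsRunList G n pos (X : Set V) l) {p : ℕ × ℕ} (hp : p ∈ l) (h2 : 2 ≤ p.2) {k : ℕ}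
    (hk : k ≤ p.2 + 1) : ∃ v ∈ legalMoves G X, ∃ l', l.Perm (p :: l') ∧
      IsRunList G n pos ((insert v X : Finset V) : Set V)
        ((p.1, k - 2) :: (p.1 + k + 1, p.2 - (k + 1)) :: l') := by
  obtain ⟨v, hvk, hv⟩ := h.exists_playable hpos hp h2 hk
  have hl := List.perm_cons_erase hp
  exact ⟨v, mem_legalMoves.mpr hv, _, hl, (h.perm hl).insert_cons hpos h2 hk hvk⟩

theorem lt_two_of_not_nonempty_legalMoves (hpos : IsCycleNumbering G n pos)
    (h : IsRunList G n pos (X : Set V) l) (hne : ¬ (legalMoves G X).Nonempty) :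
    ∀ p ∈ l, p.2 < 2 := by
  intro p hp
  by_contra! h2
  obtain ⟨v, hv, -⟩ := h.exists_mem_legalMoves_split hpos hp h2 (Nat.zero_le _)
  exact hne ⟨v, hv⟩

end IsRunList

/-- The sum of the weights of the lengths of the listed intervals. -/
def totalWeight (f : ℕ → ℕ) (l : List (ℕ × ℕ)) : ℕ := (l.map fun p => f p.2).sum

theorem totalWeight_cons (f : ℕ → ℕ) (p : ℕ × ℕ) (l : List (ℕ × ℕ)) :
    totalWeight f (p :: l) = f p.2 + totalWeight f l := rfl

theorem totalWeight_perm (f : ℕ → ℕ) {l l' : List (ℕ × ℕ)} (h : l.Perm l') :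
    totalWeight f l = totalWeight f l' :=
  (h.map _).sum_eq

theorem totalWeight_eq_zero {f : ℕ → ℕ} {l : List (ℕ × ℕ)} (h : ∀ p ∈ l, f p.2 = 0) :
    totalWeight f l = 0 := by
  refine List.sum_eq_zero fun x hx => ?_
  obtain ⟨p, hp, rfl⟩ := List.mem_map.mp hx
  exact h p hp

theorem dvd_totalWeight {f : ℕ → ℕ} {d : ℕ} {l : List (ℕ × ℕ)} (h : ∀ p ∈ l, d ∣ f p.2) :
    d ∣ totalWeight f l := by
  refine List.dvd_sum fun x hx => ?_
  obtain ⟨p, hp, rfl⟩ := List.mem_map.mp hx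
  exact h p hp

variable [Fintype V] [DecidableEq V]

theorem movesLeft_le_totalWeight (hpos : IsCycleNumbering G n pos) (X : Finset V)
    (l : List (ℕ × ℕ)) (h : IsRunList G n pos (X : Set V) l) :
    movesLeft G .staller X ≤ totalWeight upperWeight l ∧
      movesLeft G .dominator X ≤ totalWeight upperWeight l ∧
      ((∃ p ∈ l, Reducible p.2) → movesLeft G .dominator X + 1 ≤ totalWeight upperWeight l) := by
  induction hc : (Xᶜ : Finset V).card using Nat.strong_induction_on generalizing X l with
  | _ c ih =>
  subst hc
  refine ⟨movesLeft_staller_le fun v hv => ?_, ?_, ?_⟩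
  · obtain ⟨p, l', hl, h2, k, hk, hr⟩ := h.exists_split_of_mem_legalMoves hpos hv
    obtain ⟨-, h1, h3⟩ := ih _ (card_compl_insert_lt hv) _ _ hr rfl
    rw [totalWeight_perm _ hl]
    simp only [totalWeight_cons, List.mem_cons, exists_eq_or_imp] at h1 h3 ⊢
    rcases upperWeight_split h2 hk with hw | ⟨hw, hred⟩
    · omega
    · have := h3 (by tauto)
      omega
  · by_cases hne : (legalMoves G X).Nonempty
    · obtain ⟨v, hv⟩ := hne
      obtain ⟨p, hp, h2, -⟩ := h.exists_run hpos (mem_legalMoves.mp hv)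
      obtain ⟨k, hk, hw⟩ := exists_upperWeight_split h2
      obtain ⟨v, hv, l', hl, hr⟩ :=
        h.exists_mem_legalMoves_split hpos hp h2 hk
      obtain ⟨h1, -⟩ := ih _ (card_compl_insert_lt hv) _ _ hr rfl
      have := movesLeft_dominator_le hv
      rw [totalWeight_perm _ hl]
      simp only [totalWeight_cons] at h1 ⊢
      omega
    · rw [movesLeft_eq_zero hne]
      exact Nat.zero_le _
  · rintro ⟨p, hp, hred⟩
    obtain ⟨k, hk, hw⟩ := hred.exists_upperWeight_split
    have h3 := hred.1
    obtain ⟨v, hv, l', hl, hr⟩ := h.exists_mem_legalMoves_split hpos hp (by omega) hk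
    obtain ⟨h1, -⟩ := ih _ (card_compl_insert_lt hv) _ _ hr rfl
    have := movesLeft_dominator_le hv
    rw [totalWeight_perm _ hl]
    simp only [totalWeight_cons] at h1 ⊢
    omega

theorem totalWeight_le_movesLeft (hpos : IsCycleNumbering G n pos) (X : Finset V)
    (l : List (ℕ × ℕ)) (h : IsRunList G n pos (X : Set V) l) :
    totalWeight lowerWeight l ≤ 4 * movesLeft G .staller X ∧
      totalWeight lowerWeight l ≤ 4 * movesLeft G .dominator X + 3 := by
  induction hc : (Xᶜ : Finset V).card using Nat.strong_induction_on generalizing X l with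
  | _ c ih =>
  subst hc
  by_cases hne : (legalMoves G X).Nonempty
  swap
  · rw [totalWeight_eq_zero fun p hp =>
      lowerWeight_of_lt_two (h.lt_two_of_not_nonempty_legalMoves hpos hne p hp)]
    exact ⟨Nat.zero_le _, Nat.zero_le _⟩
  constructor
  · have key : ∀ p ∈ l, 2 ≤ p.2 → ∃ m < movesLeft G .staller X,
        totalWeight lowerWeight l + lowerWeight (p.2 - 1) ≤ 4 * m + 3 + lowerWeight p.2 := by
      intro p hp h2
      obtain ⟨v, hv, l', hl, hr⟩ := h.exists_mem_legalMoves_split hpos hp h2 (Nat.zero_le _)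
      obtain ⟨-, h1⟩ := ih _ (card_compl_insert_lt hv) _ _ hr rfl
      refine ⟨_, le_movesLeft_staller hv, ?_⟩
      rw [totalWeight_perm _ hl]
      simp only [totalWeight_cons] at h1 ⊢
      rw [Nat.zero_add] at h1
      omega
    by_cases hmod : ∃ p ∈ l, 2 ≤ p.2 ∧ p.2 % 5 ≠ 2
    · obtain ⟨p, hp, h2, h5⟩ := hmod
      obtain ⟨m, hm, hw⟩ := key p hp h2
      have := lowerWeight_pred h2 h5
      omega
    · push Not at hmod
      have hdvd : 4 ∣ totalWeight lowerWeight l :=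
        dvd_totalWeight fun p hp => four_dvd_lowerWeight (hmod p hp)
      obtain ⟨v, hv⟩ := hne
      obtain ⟨p, hp, h2, -⟩ := h.exists_run hpos (mem_legalMoves.mp hv)
      obtain ⟨m, hm, hw⟩ := key p hp h2
      have := lowerWeight_pred_of_mod_eq_two (hmod p hp h2)
      omega
  · obtain ⟨v, hv⟩ := hne
    have hB : (totalWeight lowerWeight l) / 4 ≤ movesLeft G .dominator X := by
      refine le_movesLeft_dominator ⟨v, hv⟩ fun v hv => ?_
      obtain ⟨p, l', hl, h2, k, hk, hr⟩ := h.exists_split_of_mem_legalMoves hpos hv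
      obtain ⟨h1, -⟩ := ih _ (card_compl_insert_lt hv) _ _ hr rfl
      have := lowerWeight_split h2 hk
      rw [totalWeight_perm _ hl]
      simp only [totalWeight_cons] at h1 ⊢
      omega
    omega

end Runs

section Cycle

open SimpleGraph

theorem exists_isCycleNumbering {n : ℕ} (hn : 4 ≤ n) (v : Fin n) :
    ∃ pos, IsCycleNumbering (cycleGraph n) n pos ∧ pos v + 1 = n := by
  obtain ⟨m, rfl⟩ : ∃ m, n = m + 2 := ⟨n - 2, by omega⟩
  refine ⟨fun x => (x - v - 1).val, ⟨fun x y h => ?_, fun x => Fin.isLt _, fun i hi => ?_,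
    fun u w h1 h2 => ?_, fun u w h1 h2 => ?_⟩, ?_⟩
  · simpa using Fin.ext h
  · exact ⟨⟨i, hi⟩ + 1 + v, by simp⟩
  · have hadj : (cycleGraph (m + 2)).Adj u w ↔
        (cycleGraph (m + 2)).Adj (u - v - 1) (w - v - 1) := by
      simp [cycleGraph_adj]
    rw [hadj, cycleGraph_adj']
    generalize u - v - 1 = a at *
    generalize w - v - 1 = b at *
    have ha := a.isLt
    have hb := b.isLt
    rcases lt_trichotomy a b with hab | rfl | hab
    · have e1 := Fin.coe_sub_iff_lt.mpr hab
      have e2 := Fin.coe_sub_iff_le.mpr hab.le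
      have : a.val < b.val := hab
      omega
    · simp
    · have e1 := Fin.coe_sub_iff_lt.mpr hab
      have e2 := Fin.coe_sub_iff_le.mpr hab.le
      have : b.val < a.val := hab
      omega
  · have hu : u - v - 1 = 0 := Fin.ext h1
    have hw : w - v - 1 = -1 := Fin.ext (by rw [Fin.coe_neg_one]; omega)
    rw [cycleGraph_adj]
    left
    calc u - w = (u - v - 1) - (w - v - 1) := by abel
      _ = 1 := by rw [hu, hw]; simp
  · simp [Fin.coe_neg_one]

theorem isRunList_singleton {n : ℕ} (hn : 4 ≤ n) (v : Fin n) :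
    ∃ pos, IsCycleNumbering (cycleGraph n) n pos ∧
      IsRunList (cycleGraph n) n pos ((insert v ∅ : Finset (Fin n)) : Set (Fin n))
        [(1, n - 3)] := by
  obtain ⟨pos, hpos, hv⟩ := exists_isCycleNumbering hn v
  refine ⟨pos, hpos, fun x => ?_, ?_, List.pairwise_singleton _ _⟩
  · have hx := hpos.pos_lt x
    have hmem : x ∈ closedNbhd (cycleGraph n) ((insert v ∅ : Finset (Fin n)) : Set (Fin n)) ↔
        x = v ∨ (cycleGraph n).Adj v x := by
      simp [closedNbhd]
    rw [hmem, ← hpos.injective.eq_iff, (cycleGraph n).adj_comm]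
    simp only [List.mem_singleton, exists_eq_left]
    rcases Nat.eq_zero_or_pos (pos x) with h0 | h0
    · have := hpos.adj_of_pos_eq_zero x v h0 hv
      simp only [this, or_true, not_true, false_iff]
      omega
    · by_cases h1 : pos x + 2 ≤ n
      · rw [hpos.adj_iff x v h0 h1]
        omega
      · have : pos x = pos v := by omega
        simp only [this, true_or, not_true, false_iff]
        omega
  · simp only [List.mem_singleton, forall_eq]
    omega

theorem mem_legalMoves_empty {n : ℕ} (hn : 4 ≤ n) (v : Fin n) :
    v ∈ legalMoves (cycleGraph n) ∅ := by
  rw [mem_legalMoves]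
  obtain ⟨m, rfl⟩ : ∃ m, n = m + 2 := ⟨n - 2, by omega⟩
  refine ⟨v, ⟨v, rfl, Or.inl rfl⟩, inNontrivialComponent_iff.mpr ⟨by simp [closedNbhd], v + 1,
    by simp [closedNbhd], ?_⟩⟩
  simp [cycleGraph_adj]

/-- The bounds on the rest of the game after the first move on a cycle. -/
theorem movesLeft_insert_empty {n : ℕ} (hn : 4 ≤ n) (v : Fin n) :
    (movesLeft (cycleGraph n) .staller (insert v ∅) ≤ upperWeight (n - 3) ∧
      lowerWeight (n - 3) ≤ 4 * movesLeft (cycleGraph n) .staller (insert v ∅)) ∧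
    (movesLeft (cycleGraph n) .dominator (insert v ∅) ≤ upperWeight (n - 3) ∧
      (Reducible (n - 3) →
        movesLeft (cycleGraph n) .dominator (insert v ∅) + 1 ≤ upperWeight (n - 3)) ∧
      lowerWeight (n - 3) ≤ 4 * movesLeft (cycleGraph n) .dominator (insert v ∅) + 3) := by
  obtain ⟨pos, hpos, hl⟩ := isRunList_singleton hn v
  have hU := movesLeft_le_totalWeight hpos _ _ hl
  have hL := totalWeight_le_movesLeft hpos _ _ hl
  simp only [List.mem_singleton, exists_eq_left, totalWeight, List.map_cons, List.map_nil,
    List.sum_singleton] at hU hL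
  exact ⟨⟨hU.1, hL.1⟩, hU.2.1, hU.2.2, hL.2⟩

theorem gameIsolationNumber_cycleGraph {n : ℕ} (hn : 4 ≤ n) :
    gameIsolationNumber (cycleGraph n) =
      2 * (n / 5) + if n % 5 = 0 then 0 else 1 := by
  have hs : ∀ v, movesLeft (cycleGraph n) .staller (insert v ∅) + 1 =
      2 * (n / 5) + if n % 5 = 0 then 0 else 1 := by
    intro v
    have h := (movesLeft_insert_empty hn v).1
    generalize movesLeft (cycleGraph n) .staller (insert v ∅) = t at *
    unfold upperWeight lowerWeight at h
    generalize hm : n - 3 = m at *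
    split_ifs at h ⊢ <;> omega
  have h0 := mem_legalMoves_empty hn ⟨0, by omega⟩
  apply le_antisymm
  · exact (movesLeft_dominator_le h0).trans (hs _).le
  · exact le_movesLeft_dominator ⟨_, h0⟩ fun v _ => (hs v).ge

theorem stallerStartGameIsolationNumber_cycleGraph {n : ℕ} (hn : 4 ≤ n) :
    stallerStartGameIsolationNumber (cycleGraph n) =
      2 * (n / 5) + if n % 5 = 4 then 1 else 0 := by
  have hs : ∀ v, movesLeft (cycleGraph n) .dominator (insert v ∅) + 1 =
      2 * (n / 5) + if n % 5 = 4 then 1 else 0 := by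
    intro v
    have h := (movesLeft_insert_empty hn v).2
    generalize movesLeft (cycleGraph n) .dominator (insert v ∅) = t at *
    unfold upperWeight lowerWeight Reducible at h
    generalize hm : n - 3 = m at *
    split_ifs at h ⊢ <;> omega
  apply le_antisymm
  · exact movesLeft_staller_le fun v _ => (hs v).le
  · exact (hs _).ge.trans (le_movesLeft_staller (mem_legalMoves_empty hn ⟨0, by omega⟩))

end Cycle

end IsolationGame

theorem theorem2p3 (n : ℕ) (hn : 4 ≤ n) :
    (IsolationGame.gameIsolationNumber (SimpleGraph.cycleGraph n) : ℤ) =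
        (if n ≡ 0 [MOD 5] then 2 * ⌈(n : ℚ) / 5⌉ else 2 * ⌈(n : ℚ) / 5⌉ - 1) ∧
      (IsolationGame.stallerStartGameIsolationNumber (SimpleGraph.cycleGraph n) : ℤ) =
        (if n ≡ 4 [MOD 5] then 2 * ⌊(n : ℚ) / 5⌋ + 1 else 2 * ⌊(n : ℚ) / 5⌋) := by
  have hfloor : ⌊(n : ℚ) / 5⌋ = ((n / 5 : ℕ) : ℤ) := by
    have := Rat.floor_intCast_div_natCast (n : ℤ) 5
    push_cast at this ⊢
    exact this
  have hceil : ⌈(n : ℚ) / 5⌉ = (((n + 4) / 5 : ℕ) : ℤ) := by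
    have hdiv := Nat.div_add_mod (n + 4) 5
    have hmod := Nat.mod_lt (n + 4) (show 0 < 5 by norm_num)
    have hlow : 5 * ((n + 4) / 5) < n + 5 := by omega
    have hhigh : n ≤ 5 * ((n + 4) / 5) := by omega
    generalize (n + 4) / 5 = q at *
    rw [Int.ceil_eq_iff]
    have hlow' : (5 * q : ℚ) < n + 5 := by exact_mod_cast hlow
    have hhigh' : (n : ℚ) ≤ 5 * q := by exact_mod_cast hhigh
    constructor
    · push_cast
      linarith
    · push_cast
      linarith
  rw [IsolationGame.gameIsolationNumber_cycleGraph hn,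
    IsolationGame.stallerStartGameIsolationNumber_cycleGraph hn, hfloor, hceil]
  unfold Nat.ModEq
  constructor
  · split_ifs <;> omega
  · split_ifs <;> omega
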